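/- Let $K=\mathbb{Q}(x_1,x_2,\ldots)$ be the field of rational functions over $\mathbb{Q}$ in countably many indeterminates, and let $\phi\colon K\to K$ be the field monomorphism with $\phi(x_i)=x_{i+1}$ for all $i\ge 1$. Let $N$ be the $(K,K)$-bimodule with underlying additive group $K$, with right action given by multiplication in $K$ and left action $\lambda\cdot n=\phi(\lambda)n$ for $\lambda\in K$, $n\in N$. Let \[ T=\begin{pmatrix}K&N&N\\0&K&K\\0&0&K\end{pmatrix},\qquad L=\begin{pmatrix}0&0&N\\0&0&0\\0&0&0\end{pmatrix},\qquad D=T/L, \] where $T$ is a ring under matrix addition and multiplication and $L$ is a two-sided ideal of $T$. Call a ring right (resp. left) coherent if each of its finitely generated right (resp. left) ideals is finitely presented, and semiprimary if its Jacobson radical is nilpotent with semisimple quotient. Then: 1. $D$ is right artinian, right noetherian and right coherent; 2. $D$ is semiprimary, and its right global dimension and its left global dimension are both equal to $2$; 3. $D$ is not left coherent; 4. the category $\operatorname{proj} D$ of finitely generated projective right $D$-modules has kernels (every morphism has a kernel in $\operatorname{proj} D$), but not all cokernels (some morphism has no cokernel in $\operatorname{proj} D$). -/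

import Mathlib

open CategoryTheory CategoryTheory.Limits MulOpposite

/-! ### Coherence, global dimension, and finitely generated projective modules.
Modules in Mathlib are left modules; right `R`-modules are modules over `Rᵐᵒᵖ`. -/

/-- A ring is left coherent if each of its finitely generated left ideals is finitely presented. -/
def IsLeftCoherent (R : Type*) [Ring R] : Prop :=
  ∀ I : Submodule R R, I.FG → Module.FinitePresentation R I

/-- A ring is right coherent if each of its finitely generated right ideals (the submodules of the
right module `R`) is finitely presented as a right module. -/
def IsRightCoherent (R : Type*) [Ring R] : Prop :=
  ∀ I : Submodule Rᵐᵒᵖ R, I.FG → Module.FinitePresentation Rᵐᵒᵖ I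

/-- A ring is right artinian if its right ideals satisfy the descending chain condition. -/
def IsRightArtinian (R : Type*) [Ring R] : Prop := IsArtinian Rᵐᵒᵖ R

/-- A ring is right noetherian if its right ideals satisfy the ascending chain condition. -/
def IsRightNoetherian (R : Type*) [Ring R] : Prop := IsNoetherian Rᵐᵒᵖ R

/-- The left global dimension: the supremum of the projective dimensions of all left modules. -/
noncomputable def leftGlobalDimension (R : Type) [Ring R] : WithBot ℕ∞ :=
  ⨆ M : ModuleCat.{0} R, projectiveDimension M

/-- The right global dimension: the supremum of the projective dimensions of all right modules. -/
noncomputable def rightGlobalDimension (R : Type) [Ring R] : WithBot ℕ∞ :=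
  ⨆ M : ModuleCat.{0} Rᵐᵒᵖ, projectiveDimension M

/-- The property of a right module of being finitely generated and projective. -/
def isFGProjective (R : Type) [Ring R] : ObjectProperty (ModuleCat.{0} Rᵐᵒᵖ) :=
  fun M => Module.Finite Rᵐᵒᵖ M ∧ Module.Projective Rᵐᵒᵖ M

/-- `proj R`: the category of finitely generated projective right `R`-modules, a full subcategory
of the category of all right `R`-modules. -/
abbrev ProjCat (R : Type) [Ring R] := (isFGProjective R).FullSubcategory

/-! ### Triangular matrices over a ring with entries in a bimodule -/

/-- Matrices with rows `(K N N)`, `(0 K K)`, `(0 0 K)`. -/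
@[ext]
structure TriMat (K N : Type*) where
  a₁₁ : K
  a₁₂ : N
  a₁₃ : N
  a₂₂ : K
  a₂₃ : K
  a₃₃ : K

namespace TriMat

variable {K N : Type*} [Ring K] [AddCommGroup N]

instance : Zero (TriMat K N) := ⟨⟨0, 0, 0, 0, 0, 0⟩⟩

instance : One (TriMat K N) := ⟨⟨1, 0, 0, 1, 0, 1⟩⟩

instance : Add (TriMat K N) :=
  ⟨fun x y => ⟨x.a₁₁ + y.a₁₁, x.a₁₂ + y.a₁₂, x.a₁₃ + y.a₁₃,
    x.a₂₂ + y.a₂₂, x.a₂₃ + y.a₂₃, x.a₃₃ + y.a₃₃⟩⟩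

instance : Neg (TriMat K N) :=
  ⟨fun x => ⟨-x.a₁₁, -x.a₁₂, -x.a₁₃, -x.a₂₂, -x.a₂₃, -x.a₃₃⟩⟩

/-- Matrix multiplication. A product of an entry `n` in `N` with an entry `k` in `K` on its right
is the right action, written `op k • n`. -/
instance [Module K N] [Module Kᵐᵒᵖ N] : Mul (TriMat K N) :=
  ⟨fun x y =>
    ⟨x.a₁₁ * y.a₁₁,
     x.a₁₁ • y.a₁₂ + op y.a₂₂ • x.a₁₂,
     x.a₁₁ • y.a₁₃ + op y.a₂₃ • x.a₁₂ + op y.a₃₃ • x.a₁₃,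
     x.a₂₂ * y.a₂₂,
     x.a₂₂ * y.a₂₃ + x.a₂₃ * y.a₃₃,
     x.a₃₃ * y.a₃₃⟩⟩

section simpLemmas

@[simp] theorem zero_a₁₁ : (0 : TriMat K N).a₁₁ = 0 := rfl
@[simp] theorem zero_a₁₂ : (0 : TriMat K N).a₁₂ = 0 := rfl
@[simp] theorem zero_a₁₃ : (0 : TriMat K N).a₁₃ = 0 := rfl
@[simp] theorem zero_a₂₂ : (0 : TriMat K N).a₂₂ = 0 := rfl
@[simp] theorem zero_a₂₃ : (0 : TriMat K N).a₂₃ = 0 := rfl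
@[simp] theorem zero_a₃₃ : (0 : TriMat K N).a₃₃ = 0 := rfl
@[simp] theorem one_a₁₁ : (1 : TriMat K N).a₁₁ = 1 := rfl
@[simp] theorem one_a₁₂ : (1 : TriMat K N).a₁₂ = 0 := rfl
@[simp] theorem one_a₁₃ : (1 : TriMat K N).a₁₃ = 0 := rfl
@[simp] theorem one_a₂₂ : (1 : TriMat K N).a₂₂ = 1 := rfl
@[simp] theorem one_a₂₃ : (1 : TriMat K N).a₂₃ = 0 := rfl
@[simp] theorem one_a₃₃ : (1 : TriMat K N).a₃₃ = 1 := rfl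

variable (x y : TriMat K N)

@[simp] theorem add_a₁₁ : (x + y).a₁₁ = x.a₁₁ + y.a₁₁ := rfl
@[simp] theorem add_a₁₂ : (x + y).a₁₂ = x.a₁₂ + y.a₁₂ := rfl
@[simp] theorem add_a₁₃ : (x + y).a₁₃ = x.a₁₃ + y.a₁₃ := rfl
@[simp] theorem add_a₂₂ : (x + y).a₂₂ = x.a₂₂ + y.a₂₂ := rfl
@[simp] theorem add_a₂₃ : (x + y).a₂₃ = x.a₂₃ + y.a₂₃ := rfl
@[simp] theorem add_a₃₃ : (x + y).a₃₃ = x.a₃₃ + y.a₃₃ := rfl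
@[simp] theorem neg_a₁₁ : (-x).a₁₁ = -x.a₁₁ := rfl
@[simp] theorem neg_a₁₂ : (-x).a₁₂ = -x.a₁₂ := rfl
@[simp] theorem neg_a₁₃ : (-x).a₁₃ = -x.a₁₃ := rfl
@[simp] theorem neg_a₂₂ : (-x).a₂₂ = -x.a₂₂ := rfl
@[simp] theorem neg_a₂₃ : (-x).a₂₃ = -x.a₂₃ := rfl
@[simp] theorem neg_a₃₃ : (-x).a₃₃ = -x.a₃₃ := rfl

variable [Module K N] [Module Kᵐᵒᵖ N]

@[simp] theorem mul_a₁₁ : (x * y).a₁₁ = x.a₁₁ * y.a₁₁ := rfl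
@[simp] theorem mul_a₁₂ : (x * y).a₁₂ = x.a₁₁ • y.a₁₂ + op y.a₂₂ • x.a₁₂ := rfl
@[simp] theorem mul_a₁₃ :
    (x * y).a₁₃ = x.a₁₁ • y.a₁₃ + op y.a₂₃ • x.a₁₂ + op y.a₃₃ • x.a₁₃ := rfl
@[simp] theorem mul_a₂₂ : (x * y).a₂₂ = x.a₂₂ * y.a₂₂ := rfl
@[simp] theorem mul_a₂₃ : (x * y).a₂₃ = x.a₂₂ * y.a₂₃ + x.a₂₃ * y.a₃₃ := rfl
@[simp] theorem mul_a₃₃ : (x * y).a₃₃ = x.a₃₃ * y.a₃₃ := rfl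

end simpLemmas

instance : AddCommGroup (TriMat K N) where
  add_assoc x y z := by ext <;> simp [add_assoc]
  zero_add x := by ext <;> simp
  add_zero x := by ext <;> simp
  neg_add_cancel x := by ext <;> simp
  add_comm x y := by ext <;> simp [add_comm]
  nsmul := nsmulRec
  zsmul := zsmulRec

variable [Module K N] [Module Kᵐᵒᵖ N] [SMulCommClass K Kᵐᵒᵖ N]

/-- For a `(K, K)`-bimodule `N`, the matrices form a ring. -/
instance : Ring (TriMat K N) where
  mul_assoc x y z := by
    ext <;> simp [mul_assoc, mul_smul, mul_add, add_mul, add_smul, smul_comm, add_assoc]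
    abel
  one_mul x := by ext <;> simp
  mul_one x := by ext <;> simp
  left_distrib x y z := by
    ext <;> simp [mul_add, add_smul] <;> abel
  right_distrib x y z := by
    ext <;> simp [add_mul, add_smul] <;> abel
  zero_mul x := by ext <;> simp
  mul_zero x := by ext <;> simp
  zsmul := zsmulRec
  neg_add_cancel := neg_add_cancel

/-- The set of matrices that vanish away from the upper right corner, as a left ideal. -/
def cornerIdeal (K N : Type*) [Ring K] [AddCommGroup N] [Module K N] [Module Kᵐᵒᵖ N]
    [SMulCommClass K Kᵐᵒᵖ N] : Ideal (TriMat K N) where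
  carrier := {x | x.a₁₁ = 0 ∧ x.a₁₂ = 0 ∧ x.a₂₂ = 0 ∧ x.a₂₃ = 0 ∧ x.a₃₃ = 0}
  add_mem' := by
    rintro x y ⟨h1, h2, h3, h4, h5⟩ ⟨g1, g2, g3, g4, g5⟩
    simp [h1, h2, h3, h4, h5, g1, g2, g3, g4, g5]
  zero_mem' := by simp
  smul_mem' := by
    rintro x y ⟨h1, h2, h3, h4, h5⟩
    simp [h1, h2, h3, h4, h5]

instance : (cornerIdeal K N).IsTwoSided where
  mul_mem_of_left := by
    rintro x y ⟨h1, h2, h3, h4, h5⟩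
    refine ⟨?_, ?_, ?_, ?_, ?_⟩ <;> simp [h1, h2, h3, h4, h5]

end TriMat

/-! ### The rings `T` and `D` -/

namespace ShiftExample

/-- The field `ℚ(x₁, x₂, …)`; the indeterminate `xᵢ` is `MvPolynomial.X (i - 1)`. -/
abbrev K : Type := FractionRing (MvPolynomial ℕ ℚ)

/-- The indeterminates, indexed from `0`. -/
noncomputable def x (i : ℕ) : K := algebraMap (MvPolynomial ℕ ℚ) K (MvPolynomial.X i)

/-- The shift endomorphism of `K`: the field homomorphism that sends each indeterminate to the
next one. -/
noncomputable def φ : K →+* K :=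
  IsFractionRing.map (A := MvPolynomial ℕ ℚ) (B := MvPolynomial ℕ ℚ)
    (j := (MvPolynomial.rename (R := ℚ) Nat.succ).toRingHom)
    (MvPolynomial.rename_injective _ Nat.succ_injective)

theorem φ_x (i : ℕ) : φ (x i) = x (i + 1) := by
  simp [φ, x, IsFractionRing.map]

/-- The `(K, K)`-bimodule `N`: its underlying additive group is that of `K`. -/
def N : Type := K

noncomputable instance : AddCommGroup N := inferInstanceAs (AddCommGroup K)

/-- The left action of `K` on `N` is `k • n = φ k * n`. -/
noncomputable instance : Module K N := Module.compHom K φ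

/-- The right action of `K` on `N` is multiplication in `K`. -/
noncomputable instance : Module Kᵐᵒᵖ N := inferInstanceAs (Module Kᵐᵒᵖ K)

theorem smul_def (k : K) (n : N) : k • n = (φ k * (show K from n) : K) := rfl

theorem op_smul_def (k : K) (n : N) : op k • n = ((show K from n) * k : K) := rfl

instance : SMulCommClass K Kᵐᵒᵖ N where
  smul_comm k l n := by
    induction l using MulOpposite.rec' with
    | _ l => exact (mul_assoc (φ k) (show K from n) l).symm

/-- The ring `T` of matrices with rows `(K N N)`, `(0 K K)`, `(0 0 K)`. -/
abbrev T : Type := TriMat K N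

/-- The ideal `L` of `T`: matrices with rows `(0 0 N)`, `(0 0 0)`, `(0 0 0)`. -/
noncomputable abbrev L : Ideal T := TriMat.cornerIdeal K N

/-- The ring `D = T / L`. -/
abbrev D : Type := T ⧸ L

end ShiftExample

/-!
The ring `D` consists of triangular matrices with entries `(a b *)`, `(0 c d)`, `(0 0 e)`, where `b`
lies in `N` and the corner is forgotten. With `K` acting from the right it has dimension five, hence
it is right artinian, and then right noetherian and right coherent. Its radical is the ideal of
entries `b`, `d`, which squares to zero, with quotient `K × K × K`.

Both global dimensions come from one computation. The diagonal idempotents `e 0`, `e 1`, `e 2`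
satisfy `D e 0 = K e 0`, `D e 1 = K e 1 + e 0 D e 1` and `D e 2 = K e 2 + e 1 D e 2`, and the rows
of `D` have the same shape in reverse order. This is `IsThreeVertexChain`. Every module has a
filtration whose steps are modules on which some `e i` acts as the identity. Such a module is a
quotient of a sum of copies of `D e i`, one for each element of a `K`-basis, with a kernel on which
`e (i - 1)` acts as the identity (`exists_projective_surjective_of_smul_eq_self`). By induction its
projective dimension is at most `i`, so every module has projective dimension at most two. A nonzero
`w` in `e 1 D e 2` generates a left ideal that is not projective, so the dimension two is attained.

Kernels of maps between finitely generated projective right modules are finitely generated because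
`D` is right noetherian, and projective because they are second syzygies. The failure of left
coherence and the missing cokernel have the same source: the left annihilator of an element `a` of a
ring `R` is finitely generated if `R` is left coherent (`IsLeftCoherent.fg_ker_toSpanSingleton`),
and also if left multiplication by `a` has a cokernel in `proj R`
(`fg_ker_toSpanSingleton_of_hasCokernels`). In `D`, let `a` be the matrix unit in position `(2, 3)`.
Its left annihilator maps onto `N`, and generators of it would make `K` finite over the image of
`φ`. This is impossible, since the indeterminate `x 0` is transcendental over that image
(`eq_zero_of_eval₂_φ_eq_zero`).
-/

universe u

/-! ### Projective dimension along surjections -/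

section ProjectiveDimension

variable {R : Type u} [Ring R] {M N : Type u} [AddCommGroup M] [Module R M]
  [AddCommGroup N] [Module R N]

theorem hasProjectiveDimensionLT_one_iff_projective :
    HasProjectiveDimensionLT (ModuleCat.of R M) 1 ↔ Module.Projective R M := by
  rw [← projective_iff_hasProjectiveDimensionLT_one, ← IsProjective.iff_projective]

theorem hasProjectiveDimensionLT_succ_of_ker {n : ℕ} [Module.Projective R M] (f : M →ₗ[R] N)
    (hf : Function.Surjective f)
    (h : HasProjectiveDimensionLT (ModuleCat.of R (LinearMap.ker f)) n) :
    HasProjectiveDimensionLT (ModuleCat.of R N) (n + 1) := by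
  have h₂ : HasProjectiveDimensionLT (ModuleCat.of R M) 1 :=
    hasProjectiveDimensionLT_one_iff_projective.2 inferInstance
  exact (LinearMap.shortExact_shortComplexKer hf).hasProjectiveDimensionLT_X₃ n h
    (hasProjectiveDimensionLT_of_ge _ 1 _ (by omega))

theorem hasProjectiveDimensionLT_ker {n : ℕ} [Module.Projective R M] (f : M →ₗ[R] N)
    (hf : Function.Surjective f)
    (h : HasProjectiveDimensionLT (ModuleCat.of R N) (n + 2)) :
    HasProjectiveDimensionLT (ModuleCat.of R (LinearMap.ker f)) (n + 1) := by
  have h₂ : HasProjectiveDimensionLT (ModuleCat.of R M) 1 :=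
    hasProjectiveDimensionLT_one_iff_projective.2 inferInstance
  exact (LinearMap.shortExact_shortComplexKer hf).hasProjectiveDimensionLT_X₁ (n + 1)
    (hasProjectiveDimensionLT_of_ge _ 1 _ (by omega)) h

theorem hasProjectiveDimensionLT_of_submodule {n : ℕ} (S : Submodule R M)
    (h₁ : HasProjectiveDimensionLT (ModuleCat.of R S) n)
    (h₃ : HasProjectiveDimensionLT (ModuleCat.of R (M ⧸ S)) n) :
    HasProjectiveDimensionLT (ModuleCat.of R M) n := by
  refine (LinearMap.shortExact_shortComplexKer S.mkQ_surjective).hasProjectiveDimensionLT_X₂ n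
    ?_ h₃
  exact hasProjectiveDimensionLT_of_iso
    (LinearEquiv.ofEq _ _ S.ker_mkQ.symm).toModuleIso n

/-- If every module has projective dimension at most two, the kernel of a map between projective
modules is projective, because it is a second syzygy of the cokernel. -/
theorem projective_ker_of_hasProjectiveDimensionLT_three
    (h : ∀ X : ModuleCat.{u} R, HasProjectiveDimensionLT X 3)
    [Module.Projective R M] [Module.Projective R N] (f : M →ₗ[R] N) :
    Module.Projective R (LinearMap.ker f) := by
  have h₁ : HasProjectiveDimensionLT (ModuleCat.of R (LinearMap.range f)) 2 := by
    have := hasProjectiveDimensionLT_ker (n := 1) (LinearMap.range f).mkQ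
      (Submodule.mkQ_surjective _) (h _)
    exact hasProjectiveDimensionLT_of_iso
      (LinearEquiv.ofEq _ _ (LinearMap.range f).ker_mkQ).toModuleIso 2
  have h₂ := hasProjectiveDimensionLT_ker (n := 0) f.rangeRestrict f.surjective_rangeRestrict h₁
  rw [zero_add, hasProjectiveDimensionLT_one_iff_projective] at h₂
  exact .of_equiv (LinearEquiv.ofEq _ _ f.ker_rangeRestrict)

end ProjectiveDimension

/-! ### Modules on which an idempotent acts as the identity -/

section Isotypic

variable {F : Type*} {R : Type u} [Field F] [Ring R] {V : Type u} [AddCommGroup V] [Module R V]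
  {ι : F →+* R} {e p : R}

/-- Let `e` be an idempotent with `R e = F e + p R e`, where `p e = 0`. A module on which `e` acts
as the identity is a quotient of a projective module, with a kernel on which `p` acts as the
identity. The projective module is a direct sum of copies of `R e`, one for each element of an
`F`-basis. -/
theorem exists_projective_surjective_of_smul_eq_self (he : IsIdempotentElem e) (hpe : p * e = 0)
    (col : ∀ x, ∃ c, x * e = ι c * e + p * x * e) (hV : ∀ v : V, e • v = v) :
    ∃ (P : Type u) (_ : AddCommGroup P) (_ : Module R P) (f : P →ₗ[R] V),
      Module.Projective R P ∧ Function.Surjective f ∧ ∀ w, f w = 0 → p • w = w := by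
  classical
  let : Module F V := Module.compHom V ι
  have hp (v : V) : p • v = 0 := by rw [← hV v, ← mul_smul, hpe, zero_smul]
  let b := Module.Basis.ofVectorSpace F V
  let Re : Submodule R R := LinearMap.range (LinearMap.toSpanSingleton R R e)
  have hRe (x : Re) : (x : R) * e = x := by
    obtain ⟨_, y, rfl⟩ := x
    simp [mul_assoc, he.eq]
  have hproj : Module.Projective R Re :=
    .of_split Re.subtype (LinearMap.toSpanSingleton R R e).rangeRestrict <| by
      ext x
      simpa using hRe x
  choose c hc using col
  have key (x : Re) (v : V) : (x : R) • v = c x • v := by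
    conv_lhs => rw [← hRe x, hc, add_smul, mul_smul, hV, mul_assoc, mul_smul, hp, add_zero]
    rfl
  let f : (Module.Basis.ofVectorSpaceIndex F V →₀ Re) →ₗ[R] V :=
    Finsupp.linearCombination R b ∘ₗ Finsupp.mapRange.linearMap Re.subtype
  have hf (w) : f w = ∑ i ∈ w.support, (w i : R) • b i := by
    simp only [f, LinearMap.comp_apply, Finsupp.linearCombination_apply]
    rw [Finsupp.mapRange.linearMap_apply, Finsupp.sum_mapRange_index (by simp)]
    rfl
  refine ⟨_, _, _, f, .of_equiv (finsuppLequivDFinsupp R).symm, ?_, ?_⟩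
  · intro v
    have hv : v ∈ Submodule.span F (Set.range b) := by rw [b.span_eq]; trivial
    induction hv using Submodule.span_induction with
    | mem x hx =>
      obtain ⟨i, rfl⟩ := hx
      refine ⟨Finsupp.single i ⟨e, 1, by simp⟩, ?_⟩
      simp [f, hV]
    | zero => exact ⟨0, map_zero f⟩
    | add x y _ _ hx hy =>
      obtain ⟨x, rfl⟩ := hx
      obtain ⟨y, rfl⟩ := hy
      exact ⟨x + y, map_add f x y⟩
    | smul a x _ hx =>
      obtain ⟨x, rfl⟩ := hx
      exact ⟨ι a • x, map_smul f _ x⟩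
  · intro w hw
    rw [hf] at hw
    simp_rw [key] at hw
    have h0 := linearIndependent_iff'.1 b.linearIndependent _ _ hw
    ext i
    by_cases hi : i ∈ w.support
    · have := hc (w i : R)
      rw [h0 i hi, map_zero, zero_mul, zero_add, mul_assoc, hRe] at this
      simpa using this.symm
    · simp [Finsupp.notMem_support_iff.1 hi]

/-- If `p` annihilates `V` and `R e = F e + p R e`, the vectors fixed by `e` form a submodule. -/
def fixedSubmodule (comm : ∀ c, ι c * e = e * ι c) (he : IsIdempotentElem e)
    (col : ∀ x, ∃ c, x * e = ι c * e + p * x * e) (hV : ∀ v : V, p • v = 0) :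
    Submodule R V where
  carrier := {v | e • v = v}
  add_mem' {v w} hv hw := by
    simp only [Set.mem_ofPred_eq] at *
    rw [smul_add, hv, hw]
  zero_mem' := smul_zero e
  smul_mem' r v hv := by
    simp only [Set.mem_ofPred_eq] at *
    obtain ⟨c, hc⟩ := col r
    have h : r • v = e • ι c • v := by
      conv_lhs => rw [← hv, ← mul_smul, hc, add_smul, mul_assoc, mul_smul p, hV, add_zero, comm,
        mul_smul]
    rw [h, ← mul_smul, he.eq]

/-- If `p` annihilates `V`, bounding the projective dimension of `V` reduces to modules on which `e`
acts as the identity and to the quotient of `V` by the vectors fixed by `e`. -/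
theorem hasProjectiveDimensionLT_of_fixedSubmodule {n : ℕ} (comm : ∀ c, ι c * e = e * ι c)
    (he : IsIdempotentElem e) (col : ∀ x, ∃ c, x * e = ι c * e + p * x * e)
    (hV : ∀ v : V, p • v = 0)
    (h₁ : ∀ (W : Type u) [AddCommGroup W] [Module R W], (∀ w : W, e • w = w) →
      HasProjectiveDimensionLT (ModuleCat.of R W) n)
    (h₂ : HasProjectiveDimensionLT (ModuleCat.of R (V ⧸ fixedSubmodule comm he col hV)) n) :
    HasProjectiveDimensionLT (ModuleCat.of R V) n :=
  hasProjectiveDimensionLT_of_submodule _ (h₁ _ fun w ↦ Subtype.ext w.2) h₂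

end Isotypic

/-! ### Chains of three idempotents -/

/-- A ring `R` over a field `F` with complete orthogonal idempotents `e 0`, `e 1`, `e 2` such that
`e i R e i = F e i` and the only other blocks `e i R e j` that may be nonzero are `e 0 R e 1` and
`e 1 R e 2`. The conditions are written column by column, as decompositions of the left ideals
`R e j`. Only the idempotents are required to commute with the image of `F`. -/
structure IsThreeVertexChain {F R : Type*} [Field F] [Ring R] (ι : F →+* R) (e : Fin 3 → R) : Prop
    extends CompleteOrthogonalIdempotents e where
  comm : ∀ i c, ι c * e i = e i * ι c
  col₀ : ∀ x, ∃ c, x * e 0 = ι c * e 0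
  col₁ : ∀ x, ∃ c, x * e 1 = ι c * e 1 + e 0 * x * e 1
  col₂ : ∀ x, ∃ c, x * e 2 = ι c * e 2 + e 1 * x * e 2

namespace IsThreeVertexChain

variable {F : Type*} {R : Type u} [Field F] [Ring R] {ι : F →+* R} {e : Fin 3 → R}

theorem hasProjectiveDimensionLT_one (h : IsThreeVertexChain ι e) (V : Type u) [AddCommGroup V]
    [Module R V] (hV : ∀ v : V, e 0 • v = v) :
    HasProjectiveDimensionLT (ModuleCat.of R V) 1 := by
  obtain ⟨P, _, _, f, hP, hf, hker⟩ := exists_projective_surjective_of_smul_eq_self (p := 0)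
    (h.idem 0) (zero_mul _) (by simpa using h.col₀) hV
  rw [hasProjectiveDimensionLT_one_iff_projective]
  refine .of_equiv (LinearEquiv.ofBijective f ⟨(injective_iff_map_eq_zero f).2 fun w hw ↦ ?_, hf⟩)
  rw [← hker w hw, zero_smul]

theorem hasProjectiveDimensionLT_two (h : IsThreeVertexChain ι e) (V : Type u) [AddCommGroup V]
    [Module R V] (hV : ∀ v : V, e 1 • v = v) :
    HasProjectiveDimensionLT (ModuleCat.of R V) 2 := by
  obtain ⟨P, _, _, f, hP, hf, hker⟩ := exists_projective_surjective_of_smul_eq_self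
    (h.idem 1) (h.ortho (by decide : (0 : Fin 3) ≠ 1)) h.col₁ hV
  exact hasProjectiveDimensionLT_succ_of_ker f hf
    (h.hasProjectiveDimensionLT_one _ fun w ↦ Subtype.ext (hker _ w.2))

theorem hasProjectiveDimensionLT_three_of_fixed (h : IsThreeVertexChain ι e) (V : Type u)
    [AddCommGroup V] [Module R V] (hV : ∀ v : V, e 2 • v = v) :
    HasProjectiveDimensionLT (ModuleCat.of R V) 3 := by
  obtain ⟨P, _, _, f, hP, hf, hker⟩ := exists_projective_surjective_of_smul_eq_self
    (h.idem 2) (h.ortho (by decide : (1 : Fin 3) ≠ 2)) h.col₂ hV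
  exact hasProjectiveDimensionLT_succ_of_ker f hf
    (h.hasProjectiveDimensionLT_two _ fun w ↦ Subtype.ext (hker _ w.2))

/-- Every module has a filtration with three steps, on the `i`-th of which `e i` acts as the
identity. -/
theorem hasProjectiveDimensionLT_three (h : IsThreeVertexChain ι e) (M : ModuleCat.{u} R) :
    HasProjectiveDimensionLT M 3 := by
  have col₀ (x : R) : ∃ c, x * e 0 = ι c * e 0 + 0 * x * e 0 := by simpa using h.col₀ x
  have hM (v : M) : (0 : R) • v = 0 := zero_smul R v
  refine hasProjectiveDimensionLT_of_fixedSubmodule (V := M) (h.comm 0) (h.idem 0) col₀ hM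
    (fun W _ _ hW ↦ ?_) ?_
  · have := h.hasProjectiveDimensionLT_one W hW
    exact hasProjectiveDimensionLT_of_ge _ 1 3 (by decide)
  let M₁ := M ⧸ fixedSubmodule (h.comm 0) (h.idem 0) col₀ hM
  have h0 (v : M₁) : e 0 • v = 0 := by
    obtain ⟨v, rfl⟩ := Submodule.mkQ_surjective _ v
    rw [← map_smul, Submodule.mkQ_apply, Submodule.Quotient.mk_eq_zero]
    change e 0 • e 0 • v = e 0 • v
    rw [← mul_smul, (h.idem 0).eq]
  refine hasProjectiveDimensionLT_of_fixedSubmodule (V := M₁) (h.comm 1) (h.idem 1)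
    h.col₁ h0 (fun W _ _ hW ↦ ?_) ?_
  · have := h.hasProjectiveDimensionLT_two W hW
    exact hasProjectiveDimensionLT_of_ge _ 2 3 (by decide)
  refine h.hasProjectiveDimensionLT_three_of_fixed _ fun v ↦ ?_
  obtain ⟨v, rfl⟩ := Submodule.mkQ_surjective _ v
  have h1 : (1 : R) = e 0 + e 1 + e 2 := by rw [← h.complete, Fin.sum_univ_three]
  rw [← map_smul]
  conv_rhs => rw [← one_smul R v, h1, add_smul, add_smul, h0, zero_add, map_add]
  refine (add_eq_right.2 ?_).symm
  rw [Submodule.mkQ_apply, Submodule.Quotient.mk_eq_zero]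
  change e 1 • e 1 • v = e 1 • v
  rw [← mul_smul, (h.idem 1).eq]

/-- The paths of length two vanish: this is what `col₂` says beyond the shape of the blocks. -/
theorem zero_mul_two (h : IsThreeVertexChain ι e) (x : R) : e 0 * x * e 2 = 0 := by
  obtain ⟨c, hc⟩ := h.col₂ x
  rw [mul_assoc, hc, mul_add, ← mul_assoc, ← h.comm, mul_assoc,
    h.ortho (by decide : (0 : Fin 3) ≠ 2), mul_assoc, ← mul_assoc (e 0),
    h.ortho (by decide : (0 : Fin 3) ≠ 1)]
  simp

/-- The left ideal generated by `w ∈ e 1 R e 2` is simple, with `e 1` acting as the identity. A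
splitting of `R → R w` would embed it into `R` so that `e 0 R e 1` annihilates its image, although
that image has a nonzero component in `F e 1`. -/
theorem not_projective_span (h : IsThreeVertexChain ι e) {w y : R} (hw₁ : e 1 * w = w)
    (hw₂ : w * e 2 = w) (hw : w ≠ 0) (hy : e 0 * y * e 1 ≠ 0) :
    ¬ Module.Projective R (LinearMap.range (LinearMap.toSpanSingleton R R w)) := by
  intro hproj
  -- `s w` generates the image of the splitting `s` of `R → R w`.
  obtain ⟨s, hs⟩ := Module.projective_lifting_property
    (LinearMap.toSpanSingleton R R w).rangeRestrict LinearMap.id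
    (LinearMap.surjective_rangeRestrict _)
  let w' : LinearMap.range (LinearMap.toSpanSingleton R R w) := ⟨w, 1, by simp⟩
  have hr : s w' * w = w := congrArg Subtype.val (LinearMap.congr_fun hs w')
  have hann : e 0 * y * e 1 * s w' = 0 := by
    have : (e 0 * y * e 1) • w' = 0 := by
      ext
      change e 0 * y * e 1 * w = 0
      rw [← hw₂, mul_assoc (e 0 * y), ← mul_assoc (e 1), hw₁, mul_assoc (e 0), ← mul_assoc y,
        ← mul_assoc, h.zero_mul_two]
    rw [← smul_eq_mul, ← map_smul, this, map_zero]
  obtain ⟨c, hc⟩ := h.col₁ (s w')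
  have hc' : e 1 * s w' * e 1 = e 1 * ι c := by
    rw [mul_assoc, hc, mul_add, ← mul_assoc, ← h.comm, mul_assoc, (h.idem 1).eq, h.comm,
      mul_assoc (e 0), ← mul_assoc (e 1) (e 0), h.ortho (by decide : (1 : Fin 3) ≠ 0), zero_mul,
      add_zero]
  have hcw : ι c * w = w := by
    rw [← hw₁, ← mul_assoc, h.comm, ← hc', mul_assoc, hw₁, mul_assoc, hr, hw₁]
  have hc0 : c ≠ 0 := by
    rintro rfl
    exact hw (by rw [← hcw, map_zero, zero_mul])
  apply hy
  have : e 0 * y * e 1 * ι c = 0 := by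
    rw [mul_assoc _ (e 1), ← hc', ← mul_assoc, ← mul_assoc, hann, zero_mul]
  rw [← mul_one (e 0 * y * e 1), ← map_one ι, ← mul_inv_cancel₀ hc0, map_mul, ← mul_assoc, this,
    zero_mul]

/-- The bound is attained by the quotient of `R` by the left ideal generated by `w`. -/
theorem iSup_projectiveDimension_eq_two (h : IsThreeVertexChain ι e) {w y : R} (hw₁ : e 1 * w = w)
    (hw₂ : w * e 2 = w) (hw : w ≠ 0) (hy : e 0 * y * e 1 ≠ 0) :
    ⨆ M : ModuleCat.{u} R, projectiveDimension M = 2 := by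
  apply le_antisymm
  · exact iSup_le fun M ↦ (projectiveDimension_le_iff M 2).2 (h.hasProjectiveDimensionLT_three M)
  · let W := LinearMap.range (LinearMap.toSpanSingleton R R w)
    refine le_iSup_of_le (ModuleCat.of R (R ⧸ W)) ((projectiveDimension_ge_iff _ 2).2 fun h₂ ↦ ?_)
    apply h.not_projective_span hw₁ hw₂ hw hy
    have := hasProjectiveDimensionLT_ker (n := 0) W.mkQ W.mkQ_surjective h₂
    rw [zero_add, hasProjectiveDimensionLT_one_iff_projective] at this
    exact .of_equiv (LinearEquiv.ofEq _ _ W.ker_mkQ)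

end IsThreeVertexChain

/-! ### Chain conditions on right modules -/

section RightModules

/-- The right module `R` is the regular module of `Rᵐᵒᵖ`. -/
def opRegularEquiv (R : Type*) [Ring R] : R ≃ₗ[Rᵐᵒᵖ] Rᵐᵒᵖ where
  __ := opAddEquiv
  map_smul' r x := by
    induction r using MulOpposite.rec'
    simp

theorem finite_op_regular (R : Type*) [Ring R] : Module.Finite Rᵐᵒᵖ R :=
  .equiv (opRegularEquiv R).symm

theorem projective_op_regular (R : Type*) [Ring R] : Module.Projective Rᵐᵒᵖ R :=
  .of_equiv (opRegularEquiv R).symm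

theorem isRightArtinian_of_isArtinianRing_op (R : Type*) [Ring R] [IsArtinianRing Rᵐᵒᵖ] :
    IsRightArtinian R :=
  isArtinian_of_linearEquiv (opRegularEquiv R).symm

theorem isRightNoetherian_of_isNoetherianRing_op (R : Type*) [Ring R] [IsNoetherianRing Rᵐᵒᵖ] :
    IsRightNoetherian R :=
  isNoetherian_of_linearEquiv (opRegularEquiv R).symm

theorem isRightCoherent_of_isNoetherianRing_op (R : Type*) [Ring R] [IsNoetherianRing Rᵐᵒᵖ] :
    IsRightCoherent R := fun I hI ↦
  have : Module.Finite Rᵐᵒᵖ I := Module.Finite.iff_fg.2 hI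
  Module.finitePresentation_of_finite Rᵐᵒᵖ I

end RightModules

/-! ### Kernels and cokernels of finitely generated projective modules -/

section ProjCat

variable {R : Type} [Ring R]

theorem hasKernels_projCat [IsNoetherianRing Rᵐᵒᵖ]
    (h : ∀ X : ModuleCat.{0} Rᵐᵒᵖ, HasProjectiveDimensionLT X 3) : HasKernels (ProjCat R) where
  has_limit {X Y} f := by
    have := X.property.1
    have := X.property.2
    have := Y.property.2
    have hK := projective_ker_of_hasProjectiveDimensionLT_three h f.hom.hom
    let Z : ProjCat R := ⟨ModuleCat.of _ (LinearMap.ker f.hom.hom), inferInstance, hK⟩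
    let i : Z ⟶ X := ObjectProperty.homMk (ModuleCat.ofHom (LinearMap.ker f.hom.hom).subtype)
    have hi : i ≫ f = 0 := by
      ext z
      exact z.2
    have : Mono i := ⟨fun s t hst ↦ by
      refine ObjectProperty.hom_ext _ (ModuleCat.hom_ext (LinearMap.ext fun w ↦ Subtype.ext ?_))
      exact congr($(hst).hom.hom w)⟩
    refine ⟨⟨⟨KernelFork.ofι i hi, KernelFork.IsLimit.ofι' i hi fun {W} k hk ↦
      ⟨ObjectProperty.homMk (ModuleCat.ofHom (k.hom.hom.codRestrict _ fun w ↦ ?_)), ?_⟩⟩⟩⟩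
    · exact congr($(hk).hom.hom w)
    · rfl

/-- Left multiplication by `a` on the right module `R` has a cokernel `R → C`. The image of `1` in
`C` is killed by `a`, and every `q` with `q a = 0` is the image of it under a homomorphism `C → R`.
By the dual basis lemma for `C`, such `q` form a finitely generated left ideal. -/
theorem fg_ker_toSpanSingleton_of_hasCokernels [HasCokernels (ProjCat R)] (a : R) :
    (LinearMap.ker (LinearMap.toSpanSingleton R R a)).FG := by
  have := finite_op_regular R
  have := projective_op_regular R
  let X : ProjCat R := ⟨ModuleCat.of Rᵐᵒᵖ R, inferInstance, inferInstance⟩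
  let l (q : R) : X ⟶ X := ObjectProperty.homMk (ModuleCat.ofHom (DistribSMul.toLinearMap Rᵐᵒᵖ R q))
  let C := cokernel (l a)
  let c : C.obj := (cokernel.π (l a)).hom (1 : R)
  have hc : op a • c = 0 := by
    have h := congr($(cokernel.condition (l a)).hom.hom (1 : R))
    change (cokernel.π (l a)).hom.hom (a * 1) = 0 at h
    rw [← h, mul_one]
    change op a • (cokernel.π (l a)).hom.hom _ = _
    rw [← map_smul]
    congr 1
    exact one_mul a
  have hdesc (q : R) (hq : q * a = 0) : ∃ g : C.obj →ₗ[Rᵐᵒᵖ] R, g c = q := by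
    have hq' : l a ≫ l q = 0 := by
      refine ObjectProperty.hom_ext _ (ModuleCat.hom_ext (LinearMap.ext fun z : R ↦ ?_))
      change q * (a * z) = 0
      rw [← mul_assoc, hq, zero_mul]
    refine ⟨(cokernel.desc (l a) (l q) hq').hom.hom, ?_⟩
    have h := congr($(cokernel.π_desc (l a) (l q) hq').hom.hom (1 : R))
    exact h.trans (mul_one q)
  have := C.property.1
  have := C.property.2
  obtain ⟨n, r, i, -, -, hri⟩ := Module.Finite.exists_comp_eq_id_of_projective Rᵐᵒᵖ C.obj
  rw [Submodule.fg_def]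
  refine ⟨Set.range fun j ↦ unop (i c j), Set.finite_range _, le_antisymm ?_ fun q hq ↦ ?_⟩
  · rw [Submodule.span_le]
    rintro _ ⟨j, rfl⟩
    have : i (op a • c) j = 0 := by rw [hc, map_zero]; rfl
    rw [map_smul] at this
    exact congrArg unop this
  · obtain ⟨g, rfl⟩ := hdesc q hq
    have hsum : c = ∑ j, i c j • r (Pi.single j 1) := by
      conv_lhs => rw [← LinearMap.id_apply (R := Rᵐᵒᵖ) c, ← hri, LinearMap.comp_apply,
        pi_eq_sum_univ' (i c)]
      simp [map_sum]
    have hg : g c = ∑ j, g (i c j • r (Pi.single j 1)) := by rw [← map_sum, ← hsum]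
    rw [hg]
    refine Submodule.sum_mem _ fun j _ ↦ ?_
    rw [map_smul]
    exact Submodule.smul_mem _ (g (r (Pi.single j 1))) (Submodule.subset_span ⟨j, rfl⟩)

/-- If `R` is left coherent, the annihilator of an element is finitely generated. -/
theorem IsLeftCoherent.fg_ker_toSpanSingleton {R : Type*} [Ring R] (h : IsLeftCoherent R) (a : R) :
    (LinearMap.ker (LinearMap.toSpanSingleton R R a)).FG := by
  have hfg : (LinearMap.range (LinearMap.toSpanSingleton R R a)).FG := by
    rw [LinearMap.range_eq_map]
    exact Module.Finite.fg_top.map _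
  have := h _ hfg
  rw [← LinearMap.ker_rangeRestrict]
  exact Module.FinitePresentation.fg_ker _ (LinearMap.surjective_rangeRestrict _)

end ProjCat

namespace ShiftExample

/-! ### The left vector space `N` is infinite-dimensional -/

theorem φ_algebraMap (p : MvPolynomial ℕ ℚ) :
    φ (algebraMap _ K p) = algebraMap _ K (MvPolynomial.rename Nat.succ p) := by
  simp [φ, IsFractionRing.map]

/-- A polynomial in one variable over a polynomial ring in countably many variables is again a
polynomial in countably many variables; the extra variable is placed at index `0`. -/
theorem eval₂_rename_succ_X_zero_injective : Function.Injective
    (Polynomial.eval₂RingHom (MvPolynomial.rename (R := ℚ) Nat.succ).toRingHom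
      (MvPolynomial.X 0)) := by
  let g : Option ℕ → ℕ := fun o ↦ o.elim 0 Nat.succ
  have hg : Function.Injective g := by
    rintro (_ | a) (_ | b) h <;> simp_all [g]
  have : (Polynomial.eval₂RingHom (MvPolynomial.rename (R := ℚ) Nat.succ).toRingHom
      (MvPolynomial.X 0)) = (MvPolynomial.rename (R := ℚ) g).toRingHom.comp
        (MvPolynomial.optionEquivLeft ℚ ℕ).symm.toAlgHom.toRingHom := by
    ext i
    · simp
    · simp [MvPolynomial.optionEquivLeft_symm_C_X, g]
    · simp [MvPolynomial.optionEquivLeft_symm_X, g]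
  rw [this]
  exact (MvPolynomial.rename_injective g hg).comp (MvPolynomial.optionEquivLeft ℚ ℕ).symm.injective

/-- The indeterminate `x 0` is transcendental over the image of `φ`. -/
theorem eq_zero_of_eval₂_φ_eq_zero (p : Polynomial K) (hp : p.eval₂ φ (x 0) = 0) : p = 0 := by
  let q := IsLocalization.integerNormalization (nonZeroDivisors (MvPolynomial ℕ ℚ)) p
  have hq : q.eval₂ (φ.comp (algebraMap _ K)) (x 0) = 0 :=
    IsLocalization.integerNormalization_eval₂_eq_zero _ φ p hp
  have hφ : φ.comp (algebraMap _ K) =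
      (algebraMap _ K).comp (MvPolynomial.rename (R := ℚ) Nat.succ).toRingHom :=
    RingHom.ext φ_algebraMap
  rw [hφ, x, ← Polynomial.hom_eval₂] at hq
  have hq' := (map_eq_zero_iff _ (IsFractionRing.injective (MvPolynomial ℕ ℚ) K)).1 hq
  have : q = 0 := (map_eq_zero_iff _ eval₂_rename_succ_X_zero_injective).1 hq'
  exact IsFractionRing.integerNormalization_eq_zero_iff.1 this

/-- The powers of `x 0` are linearly independent for the left action. -/
theorem not_finite_N : ¬ Module.Finite K N := fun _ ↦ by
  let f : Polynomial K →ₗ[K] N :=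
    { toFun p := (p.eval₂ φ (x 0) : K)
      map_add' p q := Polynomial.eval₂_add (R := K) (S := K) φ (x 0)
      map_smul' c p := Polynomial.eval₂_smul (R := K) (S := K) φ p (x 0) }
  have hf : Function.Injective f := (injective_iff_map_eq_zero f).2 eq_zero_of_eval₂_φ_eq_zero
  exact Polynomial.not_finite (Module.Finite.of_injective f hf)

/-! ### Coordinates on `D` -/

/-- The element of `D` with rows `(a b *)`, `(0 c d)`, `(0 0 e)`. -/
noncomputable def mk (a b c d e : K) : D := Ideal.Quotient.mk L ⟨a, (b : K), (0 : K), c, d, e⟩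

theorem exists_mk (z : D) : ∃ a b c d e, z = mk a b c d e := by
  obtain ⟨t, rfl⟩ := Ideal.Quotient.mk_surjective z
  refine ⟨t.a₁₁, t.a₁₂, t.a₂₂, t.a₂₃, t.a₃₃, Ideal.Quotient.eq.2 ?_⟩
  refine ⟨?_, ?_, ?_, ?_, ?_⟩ <;> simp [sub_eq_add_neg]

theorem mk_inj {a b c d e a' b' c' d' e' : K} :
    mk a b c d e = mk a' b' c' d' e' ↔ a = a' ∧ b = b' ∧ c = c' ∧ d = d' ∧ e = e' := by
  refine ⟨fun h ↦ ?_, by rintro ⟨rfl, rfl, rfl, rfl, rfl⟩; rfl⟩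
  obtain ⟨h₁, h₂, h₃, h₄, h₅⟩ := Ideal.Quotient.eq.1 h
  rw [sub_eq_add_neg] at h₁ h₂ h₃ h₄ h₅
  exact ⟨add_neg_eq_zero.1 h₁, add_neg_eq_zero.1 h₂, add_neg_eq_zero.1 h₃, add_neg_eq_zero.1 h₄,
    add_neg_eq_zero.1 h₅⟩

theorem mk_zero : mk 0 0 0 0 0 = 0 := rfl

theorem mk_one : mk 1 0 1 0 1 = 1 := rfl

theorem mk_add (a b c d e a' b' c' d' e' : K) :
    mk a b c d e + mk a' b' c' d' e' = mk (a + a') (b + b') (c + c') (d + d') (e + e') := by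
  rw [mk, mk, ← map_add, mk]
  congr 1
  ext
  case a₁₃ => exact add_zero (0 : K)
  all_goals rfl

/-- The corner entry of a product lies in `L`. -/
theorem mk_mul (a b c d e a' b' c' d' e' : K) :
    mk a b c d e * mk a' b' c' d' e' =
      mk (a * a') (φ a * b' + b * c') (c * c') (c * d' + d * e') (e * e') := by
  rw [mk, mk, ← map_mul, mk, Ideal.Quotient.eq]
  refine ⟨?_, ?_, ?_, ?_, ?_⟩ <;> rw [sub_eq_add_neg] <;> exact add_neg_cancel _

/-! ### Idempotents and global dimensions of `D` -/

/-- The scalar diagonal matrices. -/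
noncomputable def diag : K →+* D where
  toFun k := mk k 0 k 0 k
  map_one' := rfl
  map_mul' k l := by simp [mk_mul]
  map_zero' := rfl
  map_add' k l := by simp [mk_add]

theorem diag_apply (k : K) : diag k = mk k 0 k 0 k := rfl

/-- The diagonal matrix units. -/
noncomputable def unit : Fin 3 → D := ![mk 1 0 0 0 0, mk 0 0 1 0 0, mk 0 0 0 0 1]

theorem completeOrthogonalIdempotents_unit : CompleteOrthogonalIdempotents unit where
  idem i := by
    fin_cases i <;> simp [unit, IsIdempotentElem, mk_mul]
  ortho i j h := by
    fin_cases i <;> fin_cases j <;> simp_all [unit, mk_mul, mk_zero]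
  complete := by simp [Fin.sum_univ_three, unit, mk_add, mk_one]

theorem diag_mul_unit (i : Fin 3) (k : K) : diag k * unit i = unit i * diag k := by
  fin_cases i <;> simp [unit, diag_apply, mk_mul]

/-- The conditions describe the columns of `D`, and so its left modules. -/
theorem isThreeVertexChain_unit : IsThreeVertexChain diag unit where
  __ := completeOrthogonalIdempotents_unit
  comm := diag_mul_unit
  col₀ z := by
    obtain ⟨a, b, c, d, e, rfl⟩ := exists_mk z
    exact ⟨a, by simp [unit, diag_apply, mk_mul]⟩
  col₁ z := by
    obtain ⟨a, b, c, d, e, rfl⟩ := exists_mk z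
    exact ⟨c, by simp [unit, diag_apply, mk_mul, mk_add]⟩
  col₂ z := by
    obtain ⟨a, b, c, d, e, rfl⟩ := exists_mk z
    exact ⟨e, by simp [unit, diag_apply, mk_mul, mk_add]⟩

/-- The scalar diagonal matrices in the opposite ring. -/
noncomputable def opDiag : K →+* Dᵐᵒᵖ :=
  diag.toOpposite fun k l ↦ by rw [Commute, SemiconjBy, ← map_mul, mul_comm, map_mul]

theorem opDiag_apply (k : K) : opDiag k = op (mk k 0 k 0 k) := rfl

/-- Over the opposite ring the conditions describe the rows of `D`, and so its right modules. The
order of the vertices is reversed, because the last row is the simple projective one. -/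
theorem isThreeVertexChain_op_unit : IsThreeVertexChain opDiag fun i ↦ op (unit i.rev) where
  idem i := congrArg op (completeOrthogonalIdempotents_unit.idem i.rev)
  ortho i j h := congrArg op (completeOrthogonalIdempotents_unit.ortho
    (Fin.rev_injective.ne h.symm))
  complete := by
    rw [Fin.sum_univ_three, ← MulOpposite.op_add, ← MulOpposite.op_add]
    simp [unit, mk_add, mk_one]
  comm i c := congrArg op (diag_mul_unit i.rev c).symm
  col₀ z := by
    induction z using MulOpposite.rec' with | _ z
    obtain ⟨a, b, c, d, e, rfl⟩ := exists_mk z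
    exact ⟨e, by simp [unit, opDiag_apply, ← op_mul, mk_mul]⟩
  col₁ z := by
    induction z using MulOpposite.rec' with | _ z
    obtain ⟨a, b, c, d, e, rfl⟩ := exists_mk z
    exact ⟨c, by simp [unit, opDiag_apply, ← op_mul, ← MulOpposite.op_add, mk_mul, mk_add]⟩
  col₂ z := by
    induction z using MulOpposite.rec' with | _ z
    obtain ⟨a, b, c, d, e, rfl⟩ := exists_mk z
    exact ⟨a, by simp [unit, opDiag_apply, ← op_mul, ← MulOpposite.op_add, mk_mul, mk_add]⟩

theorem leftGlobalDimension_eq_two : leftGlobalDimension D = 2 :=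
  isThreeVertexChain_unit.iSup_projectiveDimension_eq_two (w := mk 0 0 0 1 0) (y := mk 0 1 0 0 0)
    (by simp [unit, mk_mul]) (by simp [unit, mk_mul]) (by simp [← mk_zero, mk_inj])
    (by simp [unit, mk_mul, ← mk_zero, mk_inj])

theorem rightGlobalDimension_eq_two : rightGlobalDimension D = 2 :=
  isThreeVertexChain_op_unit.iSup_projectiveDimension_eq_two
    (w := op (mk 0 1 0 0 0)) (y := op (mk 0 0 0 1 0))
    (by simp [unit, ← op_mul, mk_mul]) (by simp [unit, ← op_mul, mk_mul])
    (by simp [← mk_zero, mk_inj])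
    (by simp [unit, ← op_mul, mk_mul, ← mk_zero, mk_inj])

/-- The right action of `N` is plain multiplication, so `D` is a right vector space over `K` of
dimension five. -/
theorem isArtinianRing_op : IsArtinianRing Dᵐᵒᵖ := by
  let : Module K Dᵐᵒᵖ := Module.compHom Dᵐᵒᵖ opDiag
  have : IsScalarTower K Dᵐᵒᵖ Dᵐᵒᵖ := ⟨fun k y z ↦ mul_assoc (opDiag k) y z⟩
  let f : (K × K × K × K × K) →ₗ[K] Dᵐᵒᵖ :=
    { toFun v := op (mk v.1 v.2.1 v.2.2.1 v.2.2.2.1 v.2.2.2.2)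
      map_add' v w := by simp [← MulOpposite.op_add, mk_add]
      map_smul' k v := by
        change _ = opDiag k * op _
        simp [opDiag_apply, ← op_mul, mk_mul, mul_comm] }
  have hf : Function.Surjective f := fun z ↦ by
    obtain ⟨a, b, c, d, e, h⟩ := exists_mk z.unop
    exact ⟨(a, b, c, d, e), congrArg op h.symm⟩
  have : Module.Finite K Dᵐᵒᵖ := .of_surjective f hf
  exact isArtinian_of_tower K inferInstance

/-! ### The Jacobson radical of `D` -/

/-- The projection of `D` to its diagonal. -/
noncomputable def toDiagonal : D →+* K × K × K :=
  Ideal.Quotient.lift L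
    { toFun t := (t.a₁₁, t.a₂₂, t.a₃₃)
      map_one' := rfl
      map_mul' _ _ := rfl
      map_zero' := rfl
      map_add' _ _ := rfl } <| by
    rintro t ⟨h₁, -, h₂, -, h₃⟩
    simp [h₁, h₂, h₃]

theorem toDiagonal_mk (a b c d e : K) : toDiagonal (mk a b c d e) = (a, c, e) := rfl

theorem toDiagonal_surjective : Function.Surjective toDiagonal :=
  fun v ↦ ⟨mk v.1 0 v.2.1 0 v.2.2, rfl⟩

/-- The radical squares to zero, because a product of entries in positions `(1, 2)` and `(2, 3)` is
a corner entry. -/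
theorem mul_eq_zero_of_mem_ker {z w : D} (hz : z ∈ RingHom.ker toDiagonal)
    (hw : w ∈ RingHom.ker toDiagonal) : z * w = 0 := by
  obtain ⟨a, b, c, d, e, rfl⟩ := exists_mk z
  obtain ⟨a', b', c', d', e', rfl⟩ := exists_mk w
  simp only [RingHom.mem_ker, toDiagonal_mk, Prod.mk_eq_zero] at hz hw
  simp [mk_mul, hz, hw, mk_zero]

theorem jacobson_eq_ker_toDiagonal : Ring.jacobson D = RingHom.ker toDiagonal := by
  have : RingHomSurjective toDiagonal := ⟨toDiagonal_surjective⟩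
  apply le_antisymm
  · refine (Ring.le_comap_jacobson toDiagonal).trans ?_
    rw [IsSemisimpleRing.jacobson_eq_bot]
    rfl
  · intro z hz
    rw [← Ideal.jacobson_bot, Ideal.mem_jacobson_iff]
    -- `1 - y z` is the inverse of `1 + y z`, since `(y z) ^ 2 = 0`.
    refine fun y ↦ ⟨1 - y * z, ?_⟩
    have : y * z * (y * z) = 0 :=
      mul_eq_zero_of_mem_ker (Ideal.mul_mem_left _ y hz) (Ideal.mul_mem_left _ y hz)
    rw [mul_assoc, sub_mul, this]
    simp

theorem isSemiprimaryRing : IsSemiprimaryRing D where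
  isSemisimpleRing := by
    have h (I : Ideal D) [I.IsTwoSided] (hI : I = RingHom.ker toDiagonal) :
        IsSemisimpleRing (D ⧸ I) := by
      subst hI
      exact (RingHom.quotientKerEquivOfSurjective toDiagonal_surjective).symm.isSemisimpleRing
    exact h _ jacobson_eq_ker_toDiagonal
  isNilpotent := by
    refine ⟨1 + 1, ?_⟩
    rw [jacobson_eq_ker_toDiagonal, Submodule.pow_succ,
      Submodule.pow_one, Ideal.zero_eq_bot, eq_bot_iff, Ideal.mul_le]
    exact fun z hz w hw ↦ mul_eq_zero_of_mem_ker hz hw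

/-! ### An annihilator that is not finitely generated -/

/-- The entry of an element of `D` in position `(1, 2)`. -/
noncomputable def topEntry (z : D) : N := (exists_mk z).choose_spec.choose

theorem topEntry_mk (a b c d e : K) : topEntry (mk a b c d e) = b :=
  ((mk_inj.1 (exists_mk (mk a b c d e)).choose_spec.choose_spec.choose_spec.choose_spec.choose_spec
    ).2.1).symm

theorem mk_mem_ker_toSpanSingleton {a b c d e : K} :
    mk a b c d e ∈ LinearMap.ker (LinearMap.toSpanSingleton D D (mk 0 0 0 1 0)) ↔ c = 0 := by
  simp [mk_mul, ← mk_zero, mk_inj]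

/-- The left annihilator of the matrix unit in position `(2, 3)` consists of the matrices with
zero entry in position `(2, 2)`. On it, reading off the entry in position `(1, 2)` is semilinear
for the left action, so generators of it would yield generators of `N` over `K`. -/
theorem not_fg_ker_toSpanSingleton :
    ¬ (LinearMap.ker (LinearMap.toSpanSingleton D D (mk 0 0 0 1 0))).FG := by
  rintro ⟨S, hS⟩
  refine not_finite_N ⟨Submodule.fg_def.2
    ⟨topEntry '' S, S.finite_toSet.image _, eq_top_iff.2 fun n _ ↦ ?_⟩⟩
  have key (z : D) (hz : z ∈ Submodule.span D (S : Set D)) :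
      topEntry z ∈ Submodule.span K (topEntry '' (S : Set D)) := by
    induction hz using Submodule.span_induction with
    | mem z hz => exact Submodule.subset_span ⟨z, hz, rfl⟩
    | zero =>
      rw [← mk_zero, topEntry_mk]
      exact Submodule.zero_mem _
    | add z w _ _ hz hw =>
      obtain ⟨a, b, c, d, e, rfl⟩ := exists_mk z
      obtain ⟨a', b', c', d', e', rfl⟩ := exists_mk w
      rw [topEntry_mk] at hz hw
      rw [mk_add, topEntry_mk]
      exact Submodule.add_mem _ hz hw
    | smul r z hmem hz =>
      obtain ⟨a, b, c, d, e, rfl⟩ := exists_mk r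
      obtain ⟨a', b', c', d', e', rfl⟩ := exists_mk z
      rw [hS, mk_mem_ker_toSpanSingleton] at hmem
      rw [topEntry_mk] at hz
      rw [smul_eq_mul, mk_mul, topEntry_mk, hmem, mul_zero, add_zero]
      exact Submodule.smul_mem _ a hz
  exact topEntry_mk 0 n 0 0 0 ▸ key _ (hS ▸ mk_mem_ker_toSpanSingleton.2 rfl)

end ShiftExample

theorem mainTheorem6 :
    IsRightArtinian ShiftExample.D ∧
    IsRightNoetherian ShiftExample.D ∧
    IsRightCoherent ShiftExample.D ∧
    IsSemiprimaryRing ShiftExample.D ∧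
    rightGlobalDimension ShiftExample.D = 2 ∧
    leftGlobalDimension ShiftExample.D = 2 ∧
    ¬ IsLeftCoherent ShiftExample.D ∧
    HasKernels (ProjCat ShiftExample.D) ∧
    ¬ HasCokernels (ProjCat ShiftExample.D) := by
  have := ShiftExample.isArtinianRing_op
  exact ⟨isRightArtinian_of_isArtinianRing_op _, isRightNoetherian_of_isNoetherianRing_op _,
    isRightCoherent_of_isNoetherianRing_op _, ShiftExample.isSemiprimaryRing,
    ShiftExample.rightGlobalDimension_eq_two, ShiftExample.leftGlobalDimension_eq_two,
    fun h ↦ ShiftExample.not_fg_ker_toSpanSingleton (h.fg_ker_toSpanSingleton _),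
    hasKernels_projCat ShiftExample.isThreeVertexChain_op_unit.hasProjectiveDimensionLT_three,
    fun _ ↦ ShiftExample.not_fg_ker_toSpanSingleton (fg_ker_toSpanSingleton_of_hasCokernels _)⟩
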